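/- Let $\Phi_e$ denote the $e$-th partial computable function in a standard (acceptable) numbering, and let $\mathcal{K}_1$ be Kleene's first model: the partial combinatory algebra $\omega$ with the partial application $n\cdot m = \Phi_n(m)$. Closed terms over $\mathcal{K}_1$ are built from elements of $\omega$ by formal application and are coded effectively by natural numbers. A closed term is defined when all its subterms are, and $s\simeq t$ means that the closed terms $s$ and $t$ are both undefined, or are both defined and have the same value. For every ordinal $\alpha$ the relation $\sim_\alpha$ on closed terms is defined by transfinite recursion: $$s\sim_0 t \iff s\simeq t,\qquad s\sim_{\alpha+1}t\iff \forall x\in\omega\;\; s\cdot x\sim_\alpha t\cdot x,$$ $$s\sim_\alpha t\iff \exists\beta<\alpha\;\; s\sim_\beta t\quad\text{for $\alpha$ a limit ordinal.}$$ For $\Gamma$ one of the classes $\Sigma^0_m$, $\Pi^0_m$ of the arithmetical hierarchy, a relation is $\Gamma$-complete if it is in $\Gamma$ and every set $X\subseteq\omega$ in $\Gamma$ is many-one reducible to it. **Theorem.** 1. The relation $\sim_{\omega k}$ is $\Sigma^0_{2k+1}$-complete for every natural number $k>0$. 2. The relation $\sim_{\omega k+n}$ is $\Pi^0_{2k+2}$-complete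 for all natural numbers $k\ge 0$ and $n>0$. Both statements hold when the relations are considered on the closed terms over $\mathcal{K}_1$, and also when they are restricted to the elements of $\mathcal{K}_1$. -/

import Mathlib

namespace HigherExtensionality

universe u v

/-- A partial applicative structure on the set `A`: a partial binary operation. -/
structure PartialApplicativeStructure (A : Type u) where
  /-- Application `a · b`, possibly undefined. -/
  ap : A → A → Part A

/-- Closed terms over `A`: built from the elements of `A` by formal application. -/
inductive ClosedTerm (A : Type u) : Type u
  | elem : A → ClosedTerm A
  | app : ClosedTerm A → ClosedTerm A → ClosedTerm A

namespace PartialApplicativeStructure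

variable {A : Type u} (𝒜 : PartialApplicativeStructure A)

/-- The (possibly undefined) value of a closed term; it is defined only if the values of all
subterms are. -/
def eval : ClosedTerm A → Part A
  | .elem a => Part.some a
  | .app s t => (eval s).bind fun a => (eval t).bind fun b => 𝒜.ap a b

/-- Kleene equality of closed terms: both are undefined, or both are defined with equal values. -/
def KleeneEq (s t : ClosedTerm A) : Prop :=
  𝒜.eval s = 𝒜.eval t

end PartialApplicativeStructure

open ClosedTerm in
/-- A partial combinatory algebra: a partial applicative structure having combinators
`K` and `S`. -/
structure PCA (A : Type u) extends PartialApplicativeStructure A where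
  exists_K : ∃ K : A, ∀ a b : A,
    toPartialApplicativeStructure.eval (app (app (elem K) (elem a)) (elem b)) = Part.some a
  exists_S : ∃ S : A, ∀ a b : A,
    (toPartialApplicativeStructure.eval (app (app (elem S) (elem a)) (elem b))).Dom ∧
    ∀ c : A, toPartialApplicativeStructure.KleeneEq
      (app (app (app (elem S) (elem a)) (elem b)) (elem c))
      (app (app (elem a) (elem c)) (app (elem b) (elem c)))

/-- The higher extensionality relations `∼_α` on closed terms, by transfinite recursion:
`∼_0` is Kleene equality; `s ∼_{α+1} t` iff `s x ∼_α t x` for all elements `x`; and for a limit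
ordinal `α`, `s ∼_α t` iff `s ∼_β t` for some `β < α`. -/
noncomputable def PCA.Sim {A : Type u} (𝒜 : PCA A) (α : Ordinal.{v}) :
    ClosedTerm A → ClosedTerm A → Prop :=
  Ordinal.limitRecOn (motive := fun _ => ClosedTerm A → ClosedTerm A → Prop) α
    (fun s t => 𝒜.KleeneEq s t)
    (fun _ R s t => ∀ x : A, R (.app s (.elem x)) (.app t (.elem x)))
    (fun γ _ R s t => ∃ β, ∃ h : β < γ, R β h s t)

theorem PCA.sim_zero {A : Type u} (𝒜 : PCA A) (s t : ClosedTerm A) :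
    𝒜.Sim (0 : Ordinal.{v}) s t ↔ 𝒜.KleeneEq s t := by
  simp [PCA.Sim]

theorem PCA.sim_add_one {A : Type u} (𝒜 : PCA A) (α : Ordinal.{v}) (s t : ClosedTerm A) :
    𝒜.Sim (α + 1) s t ↔ ∀ x : A, 𝒜.Sim α (.app s (.elem x)) (.app t (.elem x)) := by
  simp [PCA.Sim]

theorem PCA.sim_limit {A : Type u} (𝒜 : PCA A) (α : Ordinal.{v}) (hα : Order.IsSuccLimit α)
    (s t : ClosedTerm A) :
    𝒜.Sim α s t ↔ ∃ β < α, 𝒜.Sim β s t := by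
  simp [PCA.Sim, Ordinal.limitRecOn_limit _ _ _ _ hα]

section KleeneFirstModel

open Nat.Partrec (Code)

/-- Application of Kleene's first model: `n · m = Φ_n(m)`, where `Φ_n` is the `n`-th partial
computable function. -/
def kleeneApp (n m : ℕ) : Part ℕ :=
  (Denumerable.ofNat Code n).eval m

theorem kleeneApp_encode (c : Code) (m : ℕ) :
    kleeneApp (Encodable.encode c) m = c.eval m := by
  simp [kleeneApp]

theorem exists_index {f : ℕ → ℕ} (hf : Computable f) :
    ∃ e : ℕ, ∀ a, kleeneApp e a = Part.some (f a) := by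
  obtain ⟨c, hc⟩ := Code.exists_code.1 (Partrec.nat_iff.1 hf.partrec)
  exact ⟨Encodable.encode c, fun a => by rw [kleeneApp_encode, hc]; rfl⟩

theorem partrec_kleeneApp : Partrec₂ kleeneApp :=
  Code.eval_part.comp ((Computable.ofNat Code).comp Computable.fst) Computable.snd

theorem computable_encode_curry (c : Code) :
    Computable fun n : ℕ => Encodable.encode (Code.curry c n) :=
  (Primrec.encode.comp (Code.primrec₂_curry.comp (Primrec.const c) Primrec.id)).to_comp

/-- Kleene's first model `𝒦₁`. -/
def K1 : PCA ℕ where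
  ap := kleeneApp
  exists_K := by
    obtain ⟨c, hc⟩ := Code.exists_code.1
      (Partrec.nat_iff.1 (Computable.fst.comp Computable.unpair).partrec)
    obtain ⟨K, hK⟩ := exists_index (computable_encode_curry c)
    refine ⟨K, fun a b => ?_⟩
    simp [PartialApplicativeStructure.eval, hK, kleeneApp_encode, hc]
  exists_S := by
    have hp : Partrec fun n : ℕ =>
        (kleeneApp n.unpair.1.unpair.1 n.unpair.2).bind fun x =>
          (kleeneApp n.unpair.1.unpair.2 n.unpair.2).bind fun y => kleeneApp x y := by
      have u1 : Computable fun n : ℕ => n.unpair.1 := Computable.fst.comp Computable.unpair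
      have u2 : Computable fun n : ℕ => n.unpair.2 := Computable.snd.comp Computable.unpair
      refine Partrec.bind (partrec_kleeneApp.comp (u1.comp u1) u2) ?_
      refine Partrec.bind
        (partrec_kleeneApp.comp ((u2.comp u1).comp Computable.fst)
          (u2.comp Computable.fst)) ?_
      exact partrec_kleeneApp.comp (Computable.snd.comp Computable.fst) Computable.snd
    obtain ⟨c, hc⟩ := Code.exists_code.1 (Partrec.nat_iff.1 hp)
    obtain ⟨d, hd⟩ := Code.exists_code.1 (Partrec.nat_iff.1 (computable_encode_curry c).partrec)
    obtain ⟨S, hS⟩ := exists_index (computable_encode_curry d)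
    refine ⟨S, fun a b => ⟨?_, fun e => ?_⟩⟩
    · simp [PartialApplicativeStructure.eval, hS, kleeneApp_encode, hd]
    · simp [PartialApplicativeStructure.KleeneEq, PartialApplicativeStructure.eval, hS,
        kleeneApp_encode, hd, hc]

end KleeneFirstModel

section Coding

/-- The effective coding of closed terms over `ℕ`: an element `n` has code `2n`, and an
application has code `2⟨s, t⟩ + 1`. -/
def ClosedTerm.toNat : ClosedTerm ℕ → ℕ
  | .elem n => 2 * n
  | .app s t => 2 * Nat.pair s.toNat t.toNat + 1

/-- The inverse of the coding. -/
def ClosedTerm.fromNat (n : ℕ) : ClosedTerm ℕ :=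
  if h : n % 2 = 0 then .elem (n / 2)
  else
    have h1 : (n / 2).unpair.1 < n := by
      have := Nat.unpair_left_le (n / 2)
      omega
    have h2 : (n / 2).unpair.2 < n := by
      have := Nat.unpair_right_le (n / 2)
      omega
    .app (fromNat (n / 2).unpair.1) (fromNat (n / 2).unpair.2)
termination_by n

theorem ClosedTerm.fromNat_toNat (t : ClosedTerm ℕ) : fromNat t.toNat = t := by
  induction t with
  | elem n => rw [fromNat]; simp [toNat]
  | app s t hs ht =>
    have h : (2 * Nat.pair s.toNat t.toNat + 1) / 2 = Nat.pair s.toNat t.toNat := by omega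
    rw [fromNat, toNat, dif_neg (by omega)]
    simp [h, hs, ht]

theorem ClosedTerm.toNat_fromNat (n : ℕ) : (fromNat n).toNat = n := by
  induction n using Nat.strong_induction_on with
  | _ n ih =>
    rw [fromNat]
    split_ifs with h
    · simp only [toNat]; omega
    · have h1 := Nat.unpair_left_le (n / 2)
      have h2 := Nat.unpair_right_le (n / 2)
      simp only [toNat]
      rw [ih _ (by omega), ih _ (by omega), Nat.pair_unpair]
      omega

/-- Closed terms over `ℕ` are effectively coded by natural numbers; this is the coding with
respect to which computability on closed terms is understood. -/
instance : Denumerable (ClosedTerm ℕ) :=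
  Denumerable.mk' ⟨ClosedTerm.toNat, ClosedTerm.fromNat, ClosedTerm.fromNat_toNat,
    ClosedTerm.toNat_fromNat⟩

end Coding

section ArithmeticalHierarchy

mutual

/-- `IsSigma n p`: the predicate `p` is `Σ⁰ₙ`. The `Σ⁰₀` predicates are the computable ones, and
`p` is `Σ⁰ₙ₊₁` iff `p a ↔ ∃ x : ℕ, q (a, x)` for some `Π⁰ₙ` predicate `q`. -/
def IsSigma : ℕ → ∀ {α : Type} [Primcodable α], (α → Prop) → Prop
  | 0, _, _, p => ComputablePred p
  | n + 1, α, _, p => ∃ q : α × ℕ → Prop, IsPi n q ∧ ∀ a, p a ↔ ∃ x, q (a, x)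

/-- `IsPi n p`: the predicate `p` is `Π⁰ₙ`. The `Π⁰₀` predicates are the computable ones, and
`p` is `Π⁰ₙ₊₁` iff `p a ↔ ∀ x : ℕ, q (a, x)` for some `Σ⁰ₙ` predicate `q`. -/
def IsPi : ℕ → ∀ {α : Type} [Primcodable α], (α → Prop) → Prop
  | 0, _, _, p => ComputablePred p
  | n + 1, α, _, p => ∃ q : α × ℕ → Prop, IsSigma n q ∧ ∀ a, p a ↔ ∀ x, q (a, x)

end

/-- `p` is `Σ⁰ₙ`-complete: it is `Σ⁰ₙ`, and every `Σ⁰ₙ` set of natural numbers is many-one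
reducible to it. -/
def SigmaComplete (n : ℕ) {α : Type} [Primcodable α] (p : α → Prop) : Prop :=
  IsSigma n p ∧ ∀ q : ℕ → Prop, IsSigma n q → ManyOneReducible q p

/-- `p` is `Π⁰ₙ`-complete: it is `Π⁰ₙ`, and every `Π⁰ₙ` set of natural numbers is many-one
reducible to it. -/
def PiComplete (n : ℕ) {α : Type} [Primcodable α] (p : α → Prop) : Prop :=
  IsPi n p ∧ ∀ q : ℕ → Prop, IsPi n q → ManyOneReducible q p

end ArithmeticalHierarchy

/-- `∼_α` on `𝒦₁`, as a relation on closed terms. -/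
def SimTerms (α : Ordinal.{0}) (p : ClosedTerm ℕ × ClosedTerm ℕ) : Prop :=
  K1.Sim α p.1 p.2

/-- `∼_α` on `𝒦₁`, restricted to the elements of `𝒦₁`. -/
def SimElems (α : Ordinal.{0}) (p : ℕ × ℕ) : Prop :=
  K1.Sim α (.elem p.1) (.elem p.2)

end HigherExtensionality

namespace HigherExtensionality

open Nat.Partrec (Code)

-- Monotonicity of the relations in the ordinal.

section Monotonicity

variable {A : Type*} (𝒜 : PCA A)

-- By monotonicity, a limit level `ω(k+1)` only needs the cofinal levels `ωk + n`, so `∼_{ωk+n}`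
-- becomes a relation `ValueSim k n` on possibly undefined values. Upper bounds: equality of values
-- is `∀∃` over bounded evaluations, hence `Π⁰₂`. The `n` successor steps above `ωk` merge into one
-- quantifier over coded argument sequences (`valueSim_iff_forall_appSeq`), uniformly in `n`. Each
-- limit thus adds one `∃`, and the successors above it one `∀`. Hardness is by induction on `k`:
-- every `Σ⁰_{2k+1}` predicate `q` has partial recursive `f`, `g` such that `f e ∼_{ωk} g e` exactly
-- when `q e`, while `f e ∼_{ωk+1} g e` always. Write `K` for passing to the index of a constant
-- function. It shifts finite levels above `ωk` by one and leaves level `ωk` unchanged, so `K^j`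
-- applied to such a pair delays the unconditional equivalence to level `ωk + j + 1` and below that
-- still tests `q`. The step (`exists_reduction_succ`) puts these pairs, for all `j`, into the
-- values of one pair of functions. A further `∀` over arguments gives the `Π⁰_{2k+2}` case
-- (`exists_reduction_pi`).

theorem PCA.Sim.add_one (α : Ordinal) : ∀ {s t : ClosedTerm A},
    𝒜.Sim α s t → 𝒜.Sim (α + 1) s t := by
  induction α using Ordinal.limitRecOn with
  | zero =>
    intro s t h
    rw [PCA.sim_add_one]
    intro x
    rw [PCA.sim_zero, PartialApplicativeStructure.KleeneEq] at *
    simp only [PartialApplicativeStructure.eval, h]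
  | add_one α ih =>
    intro s t h
    rw [PCA.sim_add_one] at h ⊢
    exact fun x => ih (h x)
  | limit α hα ih =>
    intro s t h
    obtain ⟨β, hβ, h⟩ := (PCA.sim_limit 𝒜 α hα s t).1 h
    have h' := (PCA.sim_add_one 𝒜 β s t).1 (ih β hβ h)
    rw [PCA.sim_add_one]
    exact fun x => (PCA.sim_limit 𝒜 α hα _ _).2 ⟨β, hβ, h' x⟩

theorem PCA.Sim.mono {α β : Ordinal} (hαβ : α ≤ β) {s t : ClosedTerm A}
    (h : 𝒜.Sim α s t) : 𝒜.Sim β s t := by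
  induction β using Ordinal.limitRecOn with
  | zero => rwa [nonpos_iff_eq_zero.1 hαβ] at h
  | add_one β ih =>
    rcases hαβ.eq_or_lt with rfl | hlt
    · exact h
    · exact PCA.Sim.add_one 𝒜 β (ih (Order.lt_add_one_iff.1 hlt))
  | limit β hβ ih =>
    rcases hαβ.eq_or_lt with rfl | hlt
    · exact h
    · exact (PCA.sim_limit 𝒜 β hβ s t).2 ⟨α, hlt, h⟩

end Monotonicity

-- The relations on values, and their behaviour under constant functions.

section ValueSim

/-- Application of a possibly undefined element of `𝒦₁` to an element. -/
def apPart (u : Part ℕ) (x : ℕ) : Part ℕ :=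
  u.bind fun a => kleeneApp a x

/-- The relation `∼_{ωk+n}` of `𝒦₁`, as a relation between the values of the terms. -/
def ValueSim : ℕ → ℕ → Part ℕ → Part ℕ → Prop
  | 0, 0, u, v => u = v
  | k + 1, 0, u, v => ∃ n, ValueSim k n u v
  | k, n + 1, u, v => ∀ x, ValueSim k n (apPart u x) (apPart v x)
termination_by k n => (k, n)

theorem valueSim_zero_zero (u v : Part ℕ) : ValueSim 0 0 u v ↔ u = v := by
  rw [ValueSim]

theorem valueSim_succ_zero (k : ℕ) (u v : Part ℕ) :
    ValueSim (k + 1) 0 u v ↔ ∃ n, ValueSim k n u v := by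
  rw [ValueSim]

theorem valueSim_succ (k n : ℕ) (u v : Part ℕ) :
    ValueSim k (n + 1) u v ↔ ∀ x, ValueSim k n (apPart u x) (apPart v x) := by
  rw [ValueSim]

theorem eval_app_elem (s : ClosedTerm ℕ) (x : ℕ) :
    K1.eval (.app s (.elem x)) = apPart (K1.eval s) x := by
  simp [PartialApplicativeStructure.eval, apPart, K1]

theorem sim_iff_valueSim (k n : ℕ) (s t : ClosedTerm ℕ) :
    K1.Sim (Ordinal.omega0 * (k : Ordinal.{0}) + (n : Ordinal.{0})) s t ↔
      ValueSim k n (K1.eval s) (K1.eval t) := by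
  induction k generalizing n s t with
  | zero =>
    induction n generalizing s t with
    | zero =>
      rw [valueSim_zero_zero]
      simp only [Nat.cast_zero, mul_zero, add_zero]
      exact PCA.sim_zero K1 s t
    | succ n ih =>
      rw [Nat.cast_add_one, ← add_assoc, PCA.sim_add_one, valueSim_succ]
      simp only [ih, eval_app_elem]
  | succ k ihk =>
    induction n generalizing s t with
    | zero =>
      rw [valueSim_succ_zero, Nat.cast_zero, add_zero, Nat.cast_add_one, mul_add, mul_one,
        PCA.sim_limit]
      · constructor
        · rintro ⟨β, hβ, h⟩
          -- The levels `ωk + n` are cofinal in `ωk + ω`, and monotonicity moves the witness up to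
          -- one of them.
          obtain ⟨c, hc, hβc⟩ := (Ordinal.lt_add_iff Ordinal.omega0_ne_zero).1 hβ
          obtain ⟨n, rfl⟩ := Ordinal.lt_omega0.1 hc
          exact ⟨n, (ihk n s t).1 (PCA.Sim.mono K1 hβc h)⟩
        · rintro ⟨n, h⟩
          exact ⟨_, by gcongr; exact Ordinal.natCast_lt_omega0 n, (ihk n s t).2 h⟩
      · exact Ordinal.isSuccLimit_add _ Ordinal.isSuccLimit_omega0
    | succ n ih =>
      rw [Nat.cast_add_one n, ← add_assoc, PCA.sim_add_one, valueSim_succ]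
      simp only [ih, eval_app_elem]

theorem ValueSim.succ {k n : ℕ} {u v : Part ℕ} (h : ValueSim k n u v) :
    ValueSim k (n + 1) u v := by
  induction n generalizing u v with
  | zero =>
    induction k generalizing u v with
    | zero =>
      rw [valueSim_zero_zero] at h
      simp [h, valueSim_succ, valueSim_zero_zero]
    | succ k ih =>
      obtain ⟨n, h⟩ := (valueSim_succ_zero k u v).1 h
      rw [valueSim_succ]
      intro x
      rw [valueSim_succ_zero]
      -- A witness of level `0` has no argument to strip, so it is first raised to level `1`.
      cases n with
      | zero => exact ⟨0, (valueSim_succ k 0 u v).1 (ih h) x⟩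
      | succ n => exact ⟨n, (valueSim_succ k n u v).1 h x⟩
  | succ n ih =>
    rw [valueSim_succ] at h ⊢
    exact fun x => ih (h x)

theorem ValueSim.mono {k m n : ℕ} (hmn : m ≤ n) {u v : Part ℕ} (h : ValueSim k m u v) :
    ValueSim k n u v :=
  Nat.le_induction h (fun _ _ => ValueSim.succ) n hmn

/-- An index of the constant function with value `a`. -/
def constIndex (a : ℕ) : ℕ :=
  Encodable.encode (Code.const a)

theorem apPart_map_constIndex (u : Part ℕ) (x : ℕ) : apPart (u.map constIndex) x = u := by
  simp [apPart, Part.bind_map, constIndex, kleeneApp_encode, Code.eval_const]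

theorem valueSim_succ_map_constIndex (k n : ℕ) (u v : Part ℕ) :
    ValueSim k (n + 1) (u.map constIndex) (v.map constIndex) ↔ ValueSim k n u v := by
  simp [valueSim_succ, apPart_map_constIndex]

/-- At level `0` this is injectivity, seen by applying both sides to an argument; at a limit the
shift by one is absorbed by the existential quantifier. -/
theorem valueSim_zero_map_constIndex (k : ℕ) (u v : Part ℕ) :
    ValueSim k 0 (u.map constIndex) (v.map constIndex) ↔ ValueSim k 0 u v := by
  induction k with
  | zero =>
    simp only [valueSim_zero_zero]
    refine ⟨fun h => ?_, fun h => h ▸ rfl⟩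
    have := congrArg (apPart · 0) h
    simpa only [apPart_map_constIndex] using this
  | succ k ih =>
    simp only [valueSim_succ_zero]
    constructor
    · rintro ⟨_ | n, h⟩
      · exact ⟨0, ih.1 h⟩
      · exact ⟨n, (valueSim_succ_map_constIndex k n u v).1 h⟩
    · rintro ⟨n, h⟩
      exact ⟨n + 1, (valueSim_succ_map_constIndex k n u v).2 h⟩

theorem map_iterate_succ (j : ℕ) (u : Part ℕ) :
    u.map constIndex^[j + 1] = (u.map constIndex^[j]).map constIndex := by
  rw [Part.map_map, Function.iterate_succ']

theorem valueSim_zero_map_iterate (k j : ℕ) (u v : Part ℕ) :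
    ValueSim k 0 (u.map constIndex^[j]) (v.map constIndex^[j]) ↔ ValueSim k 0 u v := by
  induction j with
  | zero => simp [Part.map_id']
  | succ j ih => rw [map_iterate_succ, map_iterate_succ, valueSim_zero_map_constIndex, ih]

theorem valueSim_add_map_iterate (k n j : ℕ) (u v : Part ℕ) :
    ValueSim k (n + j) (u.map constIndex^[j]) (v.map constIndex^[j]) ↔ ValueSim k n u v := by
  induction j with
  | zero => simp [Part.map_id']
  | succ j ih =>
    rw [map_iterate_succ, map_iterate_succ, ← add_assoc, valueSim_succ_map_constIndex, ih]

/-- Squeeze by monotonicity: level `n` lies between levels `0` and `j`, and at both of these the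
relation amounts to `ValueSim k 0 u v`. -/
theorem valueSim_map_iterate_of_le {k n j : ℕ} (hnj : n ≤ j) (u v : Part ℕ) :
    ValueSim k n (u.map constIndex^[j]) (v.map constIndex^[j]) ↔ ValueSim k 0 u v := by
  refine ⟨fun h => ?_, fun h => ValueSim.mono n.zero_le ((valueSim_zero_map_iterate k j u v).2 h)⟩
  have h' := ValueSim.mono hnj h
  rw [← Nat.zero_add j] at h'
  exact (valueSim_add_map_iterate k 0 j u v).1 (by simpa using h')

end ValueSim

-- Closure properties of the arithmetical hierarchy.

section Hierarchy

variable {α β : Type} [Primcodable α] [Primcodable β]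

theorem isSigma_zero (p : α → Prop) : IsSigma 0 p ↔ ComputablePred p := by
  rw [IsSigma]

theorem isPi_zero (p : α → Prop) : IsPi 0 p ↔ ComputablePred p := by
  rw [IsPi]

theorem isSigma_succ (n : ℕ) (p : α → Prop) :
    IsSigma (n + 1) p ↔ ∃ q : α × ℕ → Prop, IsPi n q ∧ ∀ a, p a ↔ ∃ x, q (a, x) := by
  rw [IsSigma]

theorem isPi_succ (n : ℕ) (p : α → Prop) :
    IsPi (n + 1) p ↔ ∃ q : α × ℕ → Prop, IsSigma n q ∧ ∀ a, p a ↔ ∀ x, q (a, x) := by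
  rw [IsPi]

/-- The two classes are defined by mutual recursion and each step enlarges the domain by a factor
`ℕ`, so both claims are proved together, for all types. -/
theorem isSigma_and_isPi_comp (n : ℕ) : ∀ {α β : Type} [Primcodable α] [Primcodable β]
    {p : β → Prop} {f : α → β}, Computable f →
    (IsSigma n p → IsSigma n fun a => p (f a)) ∧ (IsPi n p → IsPi n fun a => p (f a)) := by
  induction n with
  | zero =>
    intro α β _ _ p f hf
    have key : ComputablePred p → ComputablePred fun a => p (f a) := by
      rintro ⟨_, h⟩
      exact ⟨fun a => inferInstance, h.comp hf⟩
    simp only [isSigma_zero, isPi_zero]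
    exact ⟨key, key⟩
  | succ n ih =>
    intro α β _ _ p f hf
    have hf' : Computable fun w : α × ℕ => (f w.1, w.2) :=
      (hf.comp Computable.fst).pair Computable.snd
    simp only [isSigma_succ, isPi_succ]
    exact ⟨fun ⟨q, hq, h⟩ => ⟨fun w => q (f w.1, w.2), (ih hf').2 hq, fun a => h (f a)⟩,
      fun ⟨q, hq, h⟩ => ⟨fun w => q (f w.1, w.2), (ih hf').1 hq, fun a => h (f a)⟩⟩

theorem IsSigma.comp {n : ℕ} {p : β → Prop} (hp : IsSigma n p) {f : α → β} (hf : Computable f) :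
    IsSigma n fun a => p (f a) :=
  (isSigma_and_isPi_comp n hf).1 hp

theorem IsPi.comp {n : ℕ} {p : β → Prop} (hp : IsPi n p) {f : α → β} (hf : Computable f) :
    IsPi n fun a => p (f a) :=
  (isSigma_and_isPi_comp n hf).2 hp

theorem IsSigma.all {n : ℕ} {q : α × ℕ → Prop} (hq : IsSigma n q) :
    IsPi (n + 1) fun a => ∀ x, q (a, x) :=
  (isPi_succ n _).2 ⟨q, hq, fun _ => Iff.rfl⟩

theorem IsPi.exists {n : ℕ} {q : α × ℕ → Prop} (hq : IsPi n q) :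
    IsSigma (n + 1) fun a => ∃ x, q (a, x) :=
  (isSigma_succ n _).2 ⟨q, hq, fun _ => Iff.rfl⟩

theorem computable_pair_unpair :
    Computable fun w : α × ℕ => ((w.1, w.2.unpair.1), w.2.unpair.2) :=
  (Computable.fst.pair (Computable.fst.comp (Computable.unpair.comp Computable.snd))).pair
    (Computable.snd.comp (Computable.unpair.comp Computable.snd))

theorem IsSigma.exists {n : ℕ} {q : α × ℕ → Prop} (hq : IsSigma (n + 1) q) :
    IsSigma (n + 1) fun a => ∃ x, q (a, x) := by
  obtain ⟨r, hr, h⟩ := (isSigma_succ n q).1 hq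
  refine (isSigma_succ n _).2 ⟨_, hr.comp computable_pair_unpair, fun a => ?_⟩
  simp only [h]
  exact ⟨fun ⟨x, y, hxy⟩ => ⟨Nat.pair x y, by simpa using hxy⟩, fun ⟨z, hz⟩ => ⟨_, _, hz⟩⟩

theorem IsPi.all {n : ℕ} {q : α × ℕ → Prop} (hq : IsPi (n + 1) q) :
    IsPi (n + 1) fun a => ∀ x, q (a, x) := by
  obtain ⟨r, hr, h⟩ := (isPi_succ n q).1 hq
  refine (isPi_succ n _).2 ⟨_, hr.comp computable_pair_unpair, fun a => ?_⟩
  simp only [h]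
  exact ⟨fun H z => H _ _, fun H x y => by simpa using H (Nat.pair x y)⟩

end Hierarchy

-- Effective evaluation of closed terms.

section TermCode

theorem exists_universal_code :
    ∃ c : Code, ∀ a b : ℕ, c.eval (Nat.pair a b) = kleeneApp a b := by
  obtain ⟨c, hc⟩ := Code.exists_code.1 (Partrec.nat_iff.1 (partrec_kleeneApp.comp
    (Computable.fst.comp Computable.unpair) (Computable.snd.comp Computable.unpair)))
  exact ⟨c, fun a b => by simp [hc]⟩

/-- A code which, on input `0`, computes the value of a closed term. -/
noncomputable def termCode : ClosedTerm ℕ → Code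
  | .elem n => Code.const n
  | .app s t => Code.comp exists_universal_code.choose (Code.pair (termCode s) (termCode t))

theorem eval_termCode (t : ClosedTerm ℕ) : (termCode t).eval 0 = K1.eval t := by
  induction t with
  | elem n => simp [termCode, Code.eval_const, PartialApplicativeStructure.eval]
  | app s t hs ht =>
    simp only [termCode, Code.eval, hs, ht, PartialApplicativeStructure.eval, K1]
    simp only [Seq.seq, Part.map_eq_map, Part.bind_map]
    refine (Part.bind_assoc _ _ _).trans (congrArg _ (funext fun a => ?_))
    refine (Part.bind_map _ _ _).trans (congrArg _ (funext fun b => ?_))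
    exact exists_universal_code.choose_spec a b

theorem encode_closedTerm (t : ClosedTerm ℕ) : Encodable.encode t = t.toNat := rfl

theorem primrec_termCode : Primrec termCode := by
  -- Course-of-values recursion: `L` lists the results for all smaller term codes, so `L.length` is
  -- the current code.
  let g : Unit → List Code → Option Code := fun _ L =>
    if L.length % 2 = 0 then some (Code.const (L.length / 2))
    else L[(L.length / 2).unpair.1]?.bind fun c =>
      L[(L.length / 2).unpair.2]?.map fun d =>
        Code.comp exists_universal_code.choose (Code.pair c d)
  have hlen : Primrec fun w : Unit × List Code => w.2.length / 2 :=
    Primrec.nat_div.comp (Primrec.list_length.comp Primrec.snd) (Primrec.const 2)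
  have hg : Primrec₂ g := by
    refine Primrec.ite ?_ ?_ ?_
    · exact Primrec.eq.comp (Primrec.nat_mod.comp (Primrec.list_length.comp Primrec.snd)
        (Primrec.const 2)) (Primrec.const 0)
    · exact Primrec.option_some.comp (Code.primrec_const.comp hlen)
    · refine Primrec.option_bind (Primrec.list_getElem?.comp Primrec.snd
        (Primrec.fst.comp (Primrec.unpair.comp hlen))) ?_
      refine Primrec.option_map (Primrec.list_getElem?.comp (Primrec.snd.comp Primrec.fst)
        (Primrec.snd.comp (Primrec.unpair.comp (hlen.comp Primrec.fst)))) ?_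
      exact Code.primrec₂_comp.comp (Primrec.const _)
        (Code.primrec₂_pair.comp (Primrec.snd.comp Primrec.fst) Primrec.snd)
  have h : Primrec₂ fun (_ : Unit) n => termCode (ClosedTerm.fromNat n) := by
    refine Primrec.nat_strong_rec _ hg fun _ n => ?_
    by_cases hn : n % 2 = 0
    · rw [ClosedTerm.fromNat]
      simp [g, hn, termCode]
    · have h1 : (n / 2).unpair.1 < n := by
        have := Nat.unpair_left_le (n / 2)
        omega
      have h2 : (n / 2).unpair.2 < n := by
        have := Nat.unpair_right_le (n / 2)
        omega
      conv_rhs => rw [ClosedTerm.fromNat]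
      simp [g, hn, termCode, h1, h2]
  refine (h.comp (Primrec.const ()) Primrec.encode).of_eq fun t => ?_
  rw [encode_closedTerm, ClosedTerm.fromNat_toNat]

theorem primrec_elem : Primrec (ClosedTerm.elem : ℕ → ClosedTerm ℕ) :=
  Primrec.encode_iff.1 <| (Primrec.nat_mul.comp (Primrec.const 2) Primrec.id).of_eq fun _ => rfl

theorem primrec₂_app : Primrec₂ (ClosedTerm.app : ClosedTerm ℕ → _ → _) :=
  Primrec.encode_iff.1 <| (Primrec.succ.comp (Primrec.nat_mul.comp (Primrec.const 2)
    (Primrec₂.natPair.comp (Primrec.encode.comp Primrec.fst)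
      (Primrec.encode.comp Primrec.snd)))).of_eq fun _ => rfl

end TermCode

-- Upper bounds in the hierarchy.

section UpperBound

/-- Whatever one computation yields within `m` steps, the other yields within some `n` steps; the
matrix is decidable, so the form is `Π⁰₂`. By monotonicity of `evaln` a single `n` serves both
directions. -/
theorem eval_eq_eval_iff (c d : Code) (a : ℕ) :
    c.eval a = d.eval a ↔ ∀ m, ∃ n,
      (Code.evaln m c a = none ∨ Code.evaln n d a = Code.evaln m c a) ∧
      (Code.evaln m d a = none ∨ Code.evaln n c a = Code.evaln m d a) := by
  have key : ∀ {c d : Code}, c.eval a = d.eval a → ∀ m, ∃ n, ∀ l, n ≤ l →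
      Code.evaln m c a = none ∨ Code.evaln l d a = Code.evaln m c a := by
    intro c d h m
    rcases hv : Code.evaln m c a with _ | v
    · exact ⟨0, fun _ _ => Or.inl rfl⟩
    · have hmem : v ∈ d.eval a := h ▸ Code.evaln_sound hv
      obtain ⟨n, hn⟩ := Code.evaln_complete.1 hmem
      exact ⟨n, fun l hl => Or.inr (Code.evaln_mono hl hn)⟩
  have key' : ∀ {c d : Code}, (∀ m, ∃ n, Code.evaln m c a = none ∨
      Code.evaln n d a = Code.evaln m c a) → ∀ v ∈ c.eval a, v ∈ d.eval a := by
    intro c d h v hv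
    obtain ⟨m, hm⟩ := Code.evaln_complete.1 hv
    obtain ⟨n, hn⟩ := h m
    rw [Option.mem_def.1 hm] at hn
    exact Code.evaln_sound (by simpa using hn)
  constructor
  · intro h m
    obtain ⟨n₁, h₁⟩ := key h m
    obtain ⟨n₂, h₂⟩ := key h.symm m
    exact ⟨max n₁ n₂, h₁ _ (le_max_left _ _), h₂ _ (le_max_right _ _)⟩
  · intro h
    exact Part.ext fun v => ⟨key' (fun m => (h m).imp fun _ => And.left) v,
      key' (fun m => (h m).imp fun _ => And.right) v⟩

theorem isPi_valueSim_zero_zero :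
    IsPi 2 fun p : ClosedTerm ℕ × ClosedTerm ℕ =>
      ValueSim 0 0 (K1.eval p.1) (K1.eval p.2) := by
  let E : ((ClosedTerm ℕ × ClosedTerm ℕ) × ℕ) × ℕ → Prop := fun w =>
    (Code.evaln w.1.2 (termCode w.1.1.1) 0 = none ∨
      Code.evaln w.2 (termCode w.1.1.2) 0 = Code.evaln w.1.2 (termCode w.1.1.1) 0) ∧
    (Code.evaln w.1.2 (termCode w.1.1.2) 0 = none ∨
      Code.evaln w.2 (termCode w.1.1.1) 0 = Code.evaln w.1.2 (termCode w.1.1.2) 0)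
  have ev : ∀ {f : ((ClosedTerm ℕ × ClosedTerm ℕ) × ℕ) × ℕ → ℕ}
      {t : ((ClosedTerm ℕ × ClosedTerm ℕ) × ℕ) × ℕ → ClosedTerm ℕ}, Primrec f → Primrec t →
      Primrec fun w => Code.evaln (f w) (termCode (t w)) 0 := fun hf ht =>
    Code.primrec_evaln.comp ((hf.pair (primrec_termCode.comp ht)).pair (Primrec.const 0))
  have hm := Primrec.snd.comp
    (Primrec.fst (α := (ClosedTerm ℕ × ClosedTerm ℕ) × ℕ) (β := ℕ))
  have hs := Primrec.fst.comp (Primrec.fst.comp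
    (Primrec.fst (α := (ClosedTerm ℕ × ClosedTerm ℕ) × ℕ) (β := ℕ)))
  have ht := Primrec.snd.comp (Primrec.fst.comp
    (Primrec.fst (α := (ClosedTerm ℕ × ClosedTerm ℕ) × ℕ) (β := ℕ)))
  have hE : PrimrecPred E := by
    refine PrimrecPred.and (PrimrecPred.or ?_ ?_) (PrimrecPred.or ?_ ?_)
    · exact Primrec.eq.comp (ev hm hs) (Primrec.const none)
    · exact Primrec.eq.comp (ev Primrec.snd ht) (ev hm hs)
    · exact Primrec.eq.comp (ev hm ht) (Primrec.const none)
    · exact Primrec.eq.comp (ev Primrec.snd hs) (ev hm ht)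
  obtain ⟨dec, hdec⟩ := hE
  have hE0 : IsPi 0 E := (isPi_zero E).2 ⟨dec, hdec.to_comp⟩
  have h := hE0.exists.all
  have heq : (fun p : ClosedTerm ℕ × ClosedTerm ℕ =>
      ValueSim 0 0 (K1.eval p.1) (K1.eval p.2)) = fun p => ∀ m, ∃ n, E ((p, m), n) := by
    funext p
    rw [valueSim_zero_zero, ← eval_termCode, ← eval_termCode, eval_eq_eval_iff]
  rw [heq]
  exact h

/-- The term obtained from `s` by applying it successively to the first `n` members of the
sequence coded by `x`. -/
def appSeq (n : ℕ) (s : ClosedTerm ℕ) (x : ℕ) : ClosedTerm ℕ :=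
  ((fun w : ClosedTerm ℕ × ℕ =>
    (ClosedTerm.app w.1 (.elem w.2.unpair.1), w.2.unpair.2))^[n] (s, x)).1

theorem primrec_appSeq :
    Primrec fun w : ℕ × ClosedTerm ℕ × ℕ => appSeq w.1 w.2.1 w.2.2 := by
  refine Primrec.fst.comp (Primrec.nat_iterate Primrec.fst Primrec.snd ?_)
  have hx : Primrec fun w : (ℕ × ClosedTerm ℕ × ℕ) × ClosedTerm ℕ × ℕ => w.2.2.unpair :=
    Primrec.unpair.comp (Primrec.snd.comp Primrec.snd)
  exact (primrec₂_app.comp (Primrec.fst.comp Primrec.snd)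
    (primrec_elem.comp (Primrec.fst.comp hx))).pair (Primrec.snd.comp hx)

theorem valueSim_iff_forall_appSeq (k n : ℕ) (s t : ClosedTerm ℕ) :
    ValueSim k n (K1.eval s) (K1.eval t) ↔
      ∀ x, ValueSim k 0 (K1.eval (appSeq n s x)) (K1.eval (appSeq n t x)) := by
  induction n generalizing s t with
  | zero => simp [appSeq]
  | succ n ih =>
    have h : ∀ (s : ClosedTerm ℕ) (x : ℕ), appSeq (n + 1) s x =
        appSeq n (.app s (.elem x.unpair.1)) x.unpair.2 := fun _ _ => rfl
    simp only [valueSim_succ, ← eval_app_elem, ih, h]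
    exact ⟨fun H x => H _ _, fun H x y => by simpa using H (Nat.pair x y)⟩

/-- The finite level is part of the input, so that the next limit can quantify over it. -/
theorem isPi_valueSim (k : ℕ) :
    IsPi (2 * k + 2) fun w : (ClosedTerm ℕ × ClosedTerm ℕ) × ℕ =>
      ValueSim k w.2 (K1.eval w.1.1) (K1.eval w.1.2) := by
  have hf : Computable fun w : ((ClosedTerm ℕ × ClosedTerm ℕ) × ℕ) × ℕ =>
      (appSeq w.1.2 w.1.1.1 w.2, appSeq w.1.2 w.1.1.2 w.2) := by
    have hn := Primrec.snd.comp
      (Primrec.fst (α := (ClosedTerm ℕ × ClosedTerm ℕ) × ℕ) (β := ℕ))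
    have hp := Primrec.fst.comp
      (Primrec.fst (α := (ClosedTerm ℕ × ClosedTerm ℕ) × ℕ) (β := ℕ))
    exact ((primrec_appSeq.comp (hn.pair ((Primrec.fst.comp hp).pair Primrec.snd))).pair
      (primrec_appSeq.comp (hn.pair ((Primrec.snd.comp hp).pair Primrec.snd)))).to_comp
  induction k with
  | zero =>
    have h := (isPi_valueSim_zero_zero.comp hf).all
    simp only [← valueSim_iff_forall_appSeq] at h
    exact h
  | succ k ih =>
    have h := (ih.exists.comp hf).all
    simp only [← valueSim_succ_zero, ← valueSim_iff_forall_appSeq] at h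
    exact h

theorem isSigma_valueSim_succ_zero (k : ℕ) :
    IsSigma (2 * k + 3) fun p : ClosedTerm ℕ × ClosedTerm ℕ =>
      ValueSim (k + 1) 0 (K1.eval p.1) (K1.eval p.2) := by
  simp only [valueSim_succ_zero]
  exact (isPi_valueSim k).exists

end UpperBound

-- Reductions from arbitrary predicates of each class.

section Hardness

theorem exists_smn {f : ℕ → ℕ →. ℕ} (hf : Partrec₂ f) :
    ∃ S : ℕ → ℕ, Computable S ∧ ∀ e x, kleeneApp (S e) x = f e x := by
  obtain ⟨c, hc⟩ := Code.exists_code.1 (Partrec.nat_iff.1 (hf.comp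
    (Computable.fst.comp Computable.unpair) (Computable.snd.comp Computable.unpair)))
  refine ⟨_, computable_encode_curry c, fun e x => ?_⟩
  simp [kleeneApp_encode, hc]

theorem apPart_some (a x : ℕ) : apPart (Part.some a) x = kleeneApp a x := by
  simp [apPart]

/-- `f e` searches for a witness of `q e` and, if it halts, returns the index of the empty function
that `g` always returns. Applied to any argument, both sides are undefined. -/
theorem exists_reduction_zero {q : ℕ → Prop} (hq : IsSigma 1 q) :
    ∃ f g : ℕ →. ℕ, Partrec f ∧ Partrec g ∧
      ∀ e, (ValueSim 0 0 (f e) (g e) ↔ q e) ∧ ValueSim 0 1 (f e) (g e) := by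
  obtain ⟨r, hr, h⟩ := (isSigma_succ 0 q).1 hq
  obtain ⟨dec, hdec⟩ := (isPi_zero r).1 hr
  obtain ⟨c, hc⟩ := Code.exists_code.1 Nat.Partrec.none
  have hbot : ∀ x, kleeneApp (Encodable.encode c) x = Part.none := fun x => by
    rw [kleeneApp_encode, hc]
  refine ⟨fun e => (Nat.rfind fun x => Part.some (decide (r (e, x)))).map
    fun _ => Encodable.encode c, fun _ => Part.some (Encodable.encode c), ?_, ?_, fun e => ?_⟩
  · refine Partrec.map (Partrec.rfind ?_) (Computable.const _).to₂
    exact hdec.partrec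
  · exact (Computable.const _).partrec
  · constructor
    · rw [valueSim_zero_zero, h, Part.eq_some_iff]
      simp only [Part.mem_map_iff, ← Part.dom_iff_mem, and_true]
      exact Nat.rfind_dom.trans (by simp)
    · rw [valueSim_succ]
      intro x
      rw [valueSim_zero_zero, apPart_some, hbot]
      simp [apPart, Part.bind_map, hbot, Part.eq_none_iff]

/-- The `i`-th member of the finite sequence coded by `y`. -/
def seqGet (y i : ℕ) : ℕ :=
  (Denumerable.ofNat (List ℕ) y).getD i 0

theorem computable_seqGet : Computable₂ seqGet :=
  ((Primrec.list_getD 0).comp ((Primrec.ofNat (List ℕ)).comp Primrec.fst) Primrec.snd).to_comp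

theorem exists_seqGet_eq (z : ℕ → ℕ) (n : ℕ) : ∃ y, ∀ i ≤ n, seqGet y i = z i := by
  refine ⟨Encodable.encode ((List.range (n + 1)).map z), fun i hi => ?_⟩
  have : i < n + 1 := by omega
  simp [seqGet, List.getD, this]

theorem isSigma_bounded_seq {n : ℕ} {r : (ℕ × ℕ) × ℕ → Prop} (hr : IsSigma (n + 1) r) :
    IsSigma (n + 1) fun m : ℕ =>
      ∃ i ≤ m.unpair.2.unpair.1, r ((m.unpair.1, i), seqGet m.unpair.2.unpair.2 i) := by
  have hm : Computable fun w : ℕ × ℕ => w.1.unpair := Computable.unpair.comp Computable.fst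
  have hx : Computable fun w : ℕ × ℕ => w.1.unpair.2.unpair :=
    Computable.unpair.comp (Computable.snd.comp hm)
  have hi : Computable fun w : ℕ × ℕ => min w.2 w.1.unpair.2.unpair.1 :=
    Primrec.nat_min.to_comp.comp Computable.snd (Computable.fst.comp hx)
  have hf : Computable fun w : ℕ × ℕ => (((w.1.unpair.1, min w.2 w.1.unpair.2.unpair.1),
      seqGet w.1.unpair.2.unpair.2 (min w.2 w.1.unpair.2.unpair.1)) : (ℕ × ℕ) × ℕ) :=
    ((Computable.fst.comp hm).pair hi).pair (computable_seqGet.comp (Computable.snd.comp hx) hi)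
  have heq : (fun m : ℕ => ∃ i ≤ m.unpair.2.unpair.1,
      r ((m.unpair.1, i), seqGet m.unpair.2.unpair.2 i)) = fun m : ℕ =>
      -- Truncating `i` by `min` makes the bounded quantifier an unbounded one, which `Σ` classes
      -- absorb.
      ∃ i, r ((m.unpair.1, min i m.unpair.2.unpair.1),
        seqGet m.unpair.2.unpair.2 (min i m.unpair.2.unpair.1)) := by
    funext m
    refine propext ⟨?_, fun ⟨i, h⟩ => ⟨_, min_le_right _ _, h⟩⟩
    rintro ⟨i, hi, h⟩
    exact ⟨i, by rwa [min_eq_left hi]⟩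
  rw [heq]
  exact (hr.comp hf).exists

theorem computable_iterate_constIndex : Computable₂ fun j a : ℕ => constIndex^[j] a := by
  refine (Primrec.nat_iterate Primrec.fst Primrec.snd ?_).to_comp
  exact (Primrec.encode.comp Code.primrec_const).comp Primrec.snd

/-- For a partial recursive `f`, there is a computable `S` such that
`S e · ⟨j, y⟩ ≃ K (K (⋯ (f ⟨e, ⟨j, y⟩⟩)))`, with `j` applications of `K`. -/
theorem exists_smn_iterate {f : ℕ →. ℕ} (hf : Partrec f) :
    ∃ S : ℕ → ℕ, Computable S ∧ ∀ e x,
      kleeneApp (S e) x = (f (Nat.pair e x)).map constIndex^[x.unpair.1] := by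
  refine exists_smn (f := fun e x => (f (Nat.pair e x)).map constIndex^[x.unpair.1]) ?_
  refine Partrec.map (hf.comp Primrec₂.natPair.to_comp) ?_
  exact computable_iterate_constIndex.comp
    (Computable.fst.comp (Computable.unpair.comp (Computable.snd.comp Computable.fst)))
    Computable.snd

/-- Let `q e` be `∃ i, ∀ z, r ((e, i), z)`. On the argument `⟨j, y⟩` the two functions give `K^j` of
a pair testing `∃ i ≤ j, r ((e, i), y_i)`. These values agree at every finite level above `j`, and
up to `j` exactly when the test succeeds. -/
theorem exists_reduction_succ {k : ℕ}
    (H : ∀ q : ℕ → Prop, IsSigma (2 * k + 1) q → ∃ f g : ℕ →. ℕ, Partrec f ∧ Partrec g ∧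
      ∀ e, (ValueSim k 0 (f e) (g e) ↔ q e) ∧ ValueSim k 1 (f e) (g e))
    {q : ℕ → Prop} (hq : IsSigma (2 * k + 3) q) :
    ∃ S T : ℕ → ℕ, Computable S ∧ Computable T ∧
      ∀ e, (ValueSim (k + 1) 0 (Part.some (S e)) (Part.some (T e)) ↔ q e) ∧
        ValueSim (k + 1) 1 (Part.some (S e)) (Part.some (T e)) := by
  obtain ⟨p, hp, hqp⟩ := (isSigma_succ (2 * k + 2) q).1 hq
  obtain ⟨r, hr, hpr⟩ := (isPi_succ (2 * k + 1) p).1 hp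
  obtain ⟨f, g, hf, hg, hfg⟩ := H _ (isSigma_bounded_seq hr)
  obtain ⟨S, hS, hSf⟩ := exists_smn_iterate hf
  obtain ⟨T, hT, hTg⟩ := exists_smn_iterate hg
  simp only [hqp, hpr]
  have above : ∀ e x n, x.unpair.1 < n → ValueSim k n
      (apPart (Part.some (S e)) x) (apPart (Part.some (T e)) x) := by
    intro e x n hn
    rw [apPart_some, apPart_some, hSf, hTg]
    -- Stripping the `j` constants leaves level `m + 1 ≥ 1`, where the pair is always equivalent.
    obtain ⟨m, rfl⟩ := Nat.exists_eq_add_of_lt hn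
    rw [show x.unpair.1 + m + 1 = (m + 1) + x.unpair.1 by ring, valueSim_add_map_iterate]
    exact ((hfg _).2).mono (by omega)
  have below : ∀ e x n, n ≤ x.unpair.1 → (ValueSim k n
      (apPart (Part.some (S e)) x) (apPart (Part.some (T e)) x) ↔
        ∃ i ≤ x.unpair.1, r ((e, i), seqGet x.unpair.2 i)) := by
    intro e x n hn
    rw [apPart_some, apPart_some, hSf, hTg, valueSim_map_iterate_of_le hn, (hfg _).1]
    simp
  refine ⟨S, T, hS, hT, fun e => ⟨?_, ?_⟩⟩
  · rw [valueSim_succ_zero]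
    constructor
    · rintro ⟨n, hn⟩
      have hn' := (valueSim_succ k n _ _).1 hn.succ
      by_contra! hcon
      -- If every `i` has a counterexample `z i`, the argument `⟨n, y⟩` with `y` coding `z 0, …, z
      -- n` fails its test at level `n`.
      choose z hz using hcon
      obtain ⟨y, hy⟩ := exists_seqGet_eq z n
      obtain ⟨i, hi, hri⟩ := (below e (Nat.pair n y) n (by simp)).1 (hn' (Nat.pair n y))
      simp only [Nat.unpair_pair] at hi hri
      rw [hy i hi] at hri
      exact hz i hri
    · rintro ⟨N, hN⟩
      -- A true witness `N` passes every test with `j ≥ N`; the remaining `j < N` agree at level `N`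
      -- anyway.
      refine ⟨N + 1, (valueSim_succ k N _ _).2 fun x => ?_⟩
      by_cases hx : x.unpair.1 < N
      · exact above e x N hx
      · exact (below e x N (by omega)).2 ⟨N, by omega, hN _⟩
  · rw [valueSim_succ]
    intro x
    rw [valueSim_succ_zero]
    -- After one application `j` is fixed, so a finite level suffices regardless of `q`.
    exact ⟨x.unpair.1 + 1, above e x _ (by omega)⟩

theorem exists_reduction (k : ℕ) : ∀ q : ℕ → Prop, IsSigma (2 * k + 1) q →
    ∃ f g : ℕ →. ℕ, Partrec f ∧ Partrec g ∧
      ∀ e, (ValueSim k 0 (f e) (g e) ↔ q e) ∧ ValueSim k 1 (f e) (g e) := by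
  induction k with
  | zero => exact fun q hq => exists_reduction_zero hq
  | succ k ih =>
    intro q hq
    obtain ⟨S, T, hS, hT, h⟩ := exists_reduction_succ ih hq
    exact ⟨_, _, hS.partrec, hT.partrec, h⟩

/-- One application supplies the outer `∀`, and `n` constants move the result from level `1` to
level `n + 1`. -/
theorem exists_reduction_pi (k n : ℕ) {q : ℕ → Prop} (hq : IsPi (2 * k + 2) q) :
    ∃ S T : ℕ → ℕ, Computable S ∧ Computable T ∧
      ∀ e, ValueSim k (n + 1) (Part.some (S e)) (Part.some (T e)) ↔ q e := by
  obtain ⟨r, hr, hqr⟩ := (isPi_succ (2 * k + 1) q).1 hq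
  obtain ⟨f, g, hf, hg, hfg⟩ := exists_reduction k (fun m => r m.unpair)
    (hr.comp Computable.unpair)
  have hpair : Computable₂ Nat.pair := Primrec₂.natPair.to_comp
  obtain ⟨S, hS, hSf⟩ := exists_smn (f := fun e x => f (Nat.pair e x)) (hf.comp hpair)
  obtain ⟨T, hT, hTg⟩ := exists_smn (f := fun e x => g (Nat.pair e x)) (hg.comp hpair)
  have hK : Computable fun a => constIndex^[n] a :=
    computable_iterate_constIndex.comp (Computable.const n) Computable.id
  refine ⟨_, _, hK.comp hS, hK.comp hT, fun e => ?_⟩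
  rw [← Part.map_some constIndex^[n], ← Part.map_some constIndex^[n], add_comm n 1, valueSim_add_map_iterate, valueSim_succ,
    hqr]
  refine forall_congr' fun x => ?_
  rw [apPart_some, apPart_some, hSf, hTg, (hfg _).1, Nat.unpair_pair]

end Hardness

-- Transfer to closed terms and to elements.

section Completeness

theorem simTerms_iff (k n : ℕ) (p : ClosedTerm ℕ × ClosedTerm ℕ) :
    SimTerms (Ordinal.omega0 * (k : Ordinal.{0}) + (n : Ordinal.{0})) p ↔
      ValueSim k n (K1.eval p.1) (K1.eval p.2) :=
  sim_iff_valueSim k n p.1 p.2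

theorem computable_elem_pair :
    Computable fun p : ℕ × ℕ => (ClosedTerm.elem p.1, ClosedTerm.elem p.2) :=
  ((primrec_elem.comp Primrec.fst).pair (primrec_elem.comp Primrec.snd)).to_comp

theorem simElems_iff (k n : ℕ) (p : ℕ × ℕ) :
    SimElems (Ordinal.omega0 * (k : Ordinal.{0}) + (n : Ordinal.{0})) p ↔
      ValueSim k n (Part.some p.1) (Part.some p.2) :=
  sim_iff_valueSim k n _ _

theorem manyOneReducible_simElems {q : ℕ → Prop} {k n : ℕ} {S T : ℕ → ℕ} (hS : Computable S)
    (hT : Computable T)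
    (h : ∀ e, ValueSim k n (Part.some (S e)) (Part.some (T e)) ↔ q e) :
    ManyOneReducible q
      (SimElems (Ordinal.omega0 * (k : Ordinal.{0}) + (n : Ordinal.{0}))) :=
  ⟨fun e => (S e, T e), hS.pair hT, fun e => by rw [simElems_iff, h]⟩

theorem simElems_manyOneReducible_simTerms (α : Ordinal.{0}) :
    ManyOneReducible (SimElems α) (SimTerms α) :=
  ⟨_, computable_elem_pair, fun _ => Iff.rfl⟩

theorem sigmaComplete_of_simTerms {m : ℕ} {α : Ordinal.{0}} (h : IsSigma m (SimTerms α))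
    (hard : ∀ q : ℕ → Prop, IsSigma m q → ManyOneReducible q (SimElems α)) :
    SigmaComplete m (SimTerms α) ∧ SigmaComplete m (SimElems α) :=
  ⟨⟨h, fun q hq => (hard q hq).trans (simElems_manyOneReducible_simTerms α)⟩,
    h.comp computable_elem_pair, hard⟩

theorem piComplete_of_simTerms {m : ℕ} {α : Ordinal.{0}} (h : IsPi m (SimTerms α))
    (hard : ∀ q : ℕ → Prop, IsPi m q → ManyOneReducible q (SimElems α)) :
    PiComplete m (SimTerms α) ∧ PiComplete m (SimElems α) :=
  ⟨⟨h, fun q hq => (hard q hq).trans (simElems_manyOneReducible_simTerms α)⟩,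
    h.comp computable_elem_pair, hard⟩

end Completeness

end HigherExtensionality

theorem mainTheorem6 :
    (∀ k : ℕ, 0 < k →
      HigherExtensionality.SigmaComplete (2 * k + 1)
        (HigherExtensionality.SimTerms (Ordinal.omega0 * (k : Ordinal.{0}))) ∧
      HigherExtensionality.SigmaComplete (2 * k + 1)
        (HigherExtensionality.SimElems (Ordinal.omega0 * (k : Ordinal.{0})))) ∧
    (∀ k n : ℕ, 0 < n →
      HigherExtensionality.PiComplete (2 * k + 2)
        (HigherExtensionality.SimTerms
          (Ordinal.omega0 * (k : Ordinal.{0}) + (n : Ordinal.{0}))) ∧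
      HigherExtensionality.PiComplete (2 * k + 2)
        (HigherExtensionality.SimElems
          (Ordinal.omega0 * (k : Ordinal.{0}) + (n : Ordinal.{0})))) := by
  open HigherExtensionality in
  constructor
  · intro k hk
    obtain ⟨k, rfl⟩ := Nat.exists_eq_add_one.2 hk
    have hα : Ordinal.omega0 * ((k + 1 : ℕ) : Ordinal.{0}) =
        Ordinal.omega0 * ((k + 1 : ℕ) : Ordinal.{0}) + ((0 : ℕ) : Ordinal.{0}) := by simp
    rw [hα]
    refine sigmaComplete_of_simTerms ?_ fun q hq => ?_
    · have h := isSigma_valueSim_succ_zero k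
      simp only [← simTerms_iff] at h
      exact h
    -- The successor form is needed here: its `S` and `T` are total, so the reduction lands in
    -- elements.
    · obtain ⟨S, T, hS, hT, h⟩ := exists_reduction_succ (exists_reduction k) hq
      exact manyOneReducible_simElems hS hT fun e => (h e).1
  · intro k n hn
    obtain ⟨n, rfl⟩ := Nat.exists_eq_add_one.2 hn
    refine piComplete_of_simTerms ?_ fun q hq => ?_
    · have h := (isPi_valueSim k).comp
        (Computable.id.pair (Computable.const (n + 1)) :
          Computable fun p : ClosedTerm ℕ × ClosedTerm ℕ => (p, n + 1))
      simp only [← simTerms_iff] at h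
      exact h
    · obtain ⟨S, T, hS, hT, h⟩ := exists_reduction_pi k n hq
      exact manyOneReducible_simElems hS hT h
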